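/- Let $\alpha\in(0,1]$ and let $m\ge 1$ and $l\ge 2$ be integers. Let $(G_n)_{n\ge1}$ be the sequential preferential attachment multigraphs with parameters $\alpha$ and $m$, constructed as follows. $G_1$ is the single vertex $1$ with no edge. For $n\ge 2$, $G_n$ is obtained from $G_{n-1}$ by adding the vertex $n$ and joining it by $m$ edges, one after another, to vertices $v_1,\dots,v_m\in\{1,\dots,n-1\}$ (not necessarily distinct). Put $$\alpha_n(i)=\alpha\,\frac{2m(n-1)}{2m(n-2)+2m\alpha+(1-\alpha)(i-1)} .$$ Given $G_{n-1}$ and $v_1,\dots,v_{i-1}$, the vertex $v_i$ is chosen uniformly from $\{1,\dots,n-1\}$ with probability $\alpha_n(i)$, and with probability $1-\alpha_n(i)$ it equals $k$ with probability $$\frac{\deg_{G_{n-1}}(k)+|\{1\le j\le i-1: v_j=k\}|}{2m(n-2)+i-1}\qquad(1\le k\le n-1).$$ (For $n=2$, $i=1$ one has $\alpha_2(1)=1$, so that only the uniform choice occurs.) A cycle of length $l$ consists of $l$ distinct vertices in cyclic order together with $l$ distinct edges joining consecutive ones; in particular a cycle of length $2$ is a pair of parallel edges. Let $\rho_l(n)$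 be the probability that a cycle of length $l$ is created when the vertex $n$ is added, that is, that $G_n$ has a cycle of length $l$ through $n$. Then $$\sup_{n} n\,\rho_l(n)<\infty .$$ -/

import Mathlib

open scoped ENNReal

namespace PrefAttach

/-- The edges of an undirected multigraph whose vertices are natural numbers: the multiplicity of
`s(u, v)` is the number of parallel edges between `u` and `v`. -/
abbrev Edges := Multiset (Sym2 ℕ)

/-- Degree of the vertex `k`, parallel edges counted with multiplicity (the graphs constructed
below have no loops). -/
def degree (E : Edges) (k : ℕ) : ℕ := E.countP (fun e => k ∈ e)

/-- The probability `α_n(i)` with which the `i`-th edge (`1 ≤ i ≤ m`) of the new vertex `n` is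
attached to a uniformly chosen older vertex. -/
noncomputable def uniformCoeff (α : ℝ) (m n i : ℕ) : ℝ :=
  α * (2 * m * ((n : ℝ) - 1) / (2 * m * ((n : ℝ) - 2) + 2 * m * α + (1 - α) * ((i : ℝ) - 1)))

/-- The probability that the `i`-th edge of the new vertex `n` is attached to `k ∈ {1, …, n - 1}`
when `E` is the collection of all edges added so far (the edges of the graph on `n - 1` vertices
together with the first `i - 1` edges of `n`): with probability `α_n(i)` the endpoint is uniform,
with probability `1 - α_n(i)` it is chosen in proportion to the current degrees. -/
noncomputable def attachProb (α : ℝ) (m n i : ℕ) (E : Edges) (k : ℕ) : ℝ :=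
  uniformCoeff α m n i * (1 / ((n : ℝ) - 1)) +
    (1 - uniformCoeff α m n i) *
      ((degree E k : ℝ) / (2 * m * ((n : ℝ) - 2) + ((i : ℝ) - 1)))

/-- `attachProb` as a function on all vertex labels, zero outside `{1, …, n - 1}`. -/
noncomputable def attachWeight (α : ℝ) (m n i : ℕ) (E : Edges) (k : ℕ) : ℝ≥0∞ :=
  if k ∈ Finset.Icc 1 (n - 1) then ENNReal.ofReal (attachProb α m n i E k) else 0

theorem attachWeight_of_notMem (α : ℝ) (m n i : ℕ) (E : Edges) {k : ℕ}
    (hk : k ∉ Finset.Icc 1 (n - 1)) : attachWeight α m n i E k = 0 := if_neg hk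

open Classical in
/-- The law of the older endpoint of the `i`-th edge of the new vertex `n`, given the edges `E`
added so far. The second branch only serves to make the function total: by
`attachWeight_sum_of_mem_support` below, the weights sum to one at every configuration that the
process can reach. -/
noncomputable def attach (α : ℝ) (m n i : ℕ) (E : Edges) : PMF ℕ :=
  if h : ∑ k ∈ Finset.Icc 1 (n - 1), attachWeight α m n i E k = 1 then
    PMF.ofFinset (attachWeight α m n i E) (Finset.Icc 1 (n - 1)) h
      (fun _ hk => attachWeight_of_notMem α m n i E hk)
  else PMF.pure 1

/-- The law of the edge collection after the first `i` edges of the new vertex `n` have been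
attached one by one, starting from the edge collection `E`. -/
noncomputable def addEdges (α : ℝ) (m n : ℕ) : ℕ → Edges → PMF Edges
  | 0, E => PMF.pure E
  | i + 1, E => (addEdges α m n i E).bind fun E' =>
      (attach α m n (i + 1) E').map fun k => s(n, k) ::ₘ E'

/-- The law of the sequential preferential attachment multigraph `G_n` on the vertex set
`{1, …, n}`, with parameters `α` and `m`: `G_1` has no edges, and each new vertex sends `m` edges,
attached one after another, to the older vertices. (`n = 0` is the empty graph.) -/
noncomputable def graphLaw (α : ℝ) (m : ℕ) : ℕ → PMF Edges
  | 0 => PMF.pure 0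
  | 1 => PMF.pure 0
  | n + 2 => (graphLaw α m (n + 1)).bind fun E => addEdges α m (n + 2) m E

/-- `w 0, w 1, …, w (l - 1), w 0` is a cycle of length `l` of the multigraph with edges `E`: the
vertices are distinct, and the `l` edges joining consecutive vertices can be chosen distinct in
`E`. So a cycle of length two is a pair of parallel edges. -/
def IsCycle (E : Edges) {l : ℕ} (w : Fin l → ℕ) : Prop :=
  Function.Injective w ∧
    (Finset.univ : Finset (Fin l)).val.map (fun i => s(w i, w (finRotate l i))) ≤ E

/-- The multigraph `G_n` with edges `E` has a cycle of length `l` which was created by the addition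
of its last vertex `n`. As all the edges added with `n` are incident to `n`, these are the cycles
through `n`. -/
def CycleCreated (l n : ℕ) (E : Edges) : Prop :=
  ∃ w : Fin l → ℕ, IsCycle E w ∧ ∃ i, w i = n

/-- The probability `ρ_l(n)` that the addition of the vertex `n` creates a cycle of length `l`. -/
noncomputable def cycleProb (α : ℝ) (m l n : ℕ) : ℝ≥0∞ :=
  (graphLaw α m n).toOuterMeasure {E | CycleCreated l n E}

/-! The attachment weights sum to one along the process. -/

/-- Degree bookkeeping when the vertex `n` has received `i` of its edges. -/
def Balanced (m n i : ℕ) (E : Edges) : Prop :=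
  ∑ k ∈ Finset.Icc 1 (n - 1), degree E k = 2 * m * (n - 2) + i ∧
    degree E n = i ∧ ∀ k, n < k → degree E k = 0

theorem degree_cons (E : Edges) (n j k : ℕ) :
    degree (s(n, j) ::ₘ E) k = degree E k + if k = n ∨ k = j then 1 else 0 := by
  simp [degree, Multiset.countP_cons]

theorem attachWeight_sum {α : ℝ} (hα : 0 < α) (hα1 : α ≤ 1) {m n i : ℕ} (hm : 1 ≤ m)
    (hn : 2 ≤ n) {E : Edges} (hE : Balanced m n i E) :
    ∑ k ∈ Finset.Icc 1 (n - 1), attachWeight α m n (i + 1) E k = 1 := by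
  obtain ⟨h1, -, -⟩ := hE
  obtain ⟨p, rfl⟩ : ∃ p, n = p + 2 := ⟨n - 2, by omega⟩
  have hm' : (1 : ℝ) ≤ m := by exact_mod_cast hm
  have hp : (0 : ℝ) ≤ p := Nat.cast_nonneg p
  have hi : (0 : ℝ) ≤ i := Nat.cast_nonneg i
  have hb : 0 ≤ 1 - α := by linarith
  set D : ℝ := 2 * m * p + 2 * m * α + (1 - α) * i with hD
  have hDpos : 0 < D := by positivity
  have hc : uniformCoeff α m (p + 2) (i + 1) = α * (2 * m * (p + 1) / D) := by
    unfold uniformCoeff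
    push_cast
    rw [hD]
    congr 3 <;> ring
  have hc1 : 1 - uniformCoeff α m (p + 2) (i + 1) = (1 - α) * (2 * m * p + i) / D := by
    rw [hc]; field_simp; rw [hD]; ring
  have hS : (∑ k ∈ Finset.Icc 1 (p + 1), (degree E k : ℝ)) = 2 * m * p + i := by
    have : ((∑ k ∈ Finset.Icc 1 (p + 1), degree E k : ℕ) : ℝ) = ((2 * m * p + i : ℕ) : ℝ) := by
      exact_mod_cast h1
    push_cast at this
    exact this
  have hnn : ∀ k, 0 ≤ attachProb α m (p + 2) (i + 1) E k := by
    intro k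
    unfold attachProb
    rw [hc1, hc]
    push_cast
    have e1 : (p : ℝ) + 2 - 1 = p + 1 := by ring
    have e2 : (p : ℝ) + 2 - 2 = p := by ring
    have e3 : (i : ℝ) + 1 - 1 = i := by ring
    rw [e1, e2, e3]
    positivity
  have hw : ∀ k ∈ Finset.Icc 1 (p + 2 - 1), attachWeight α m (p + 2) (i + 1) E k
      = ENNReal.ofReal (attachProb α m (p + 2) (i + 1) E k) := fun k hk => if_pos hk
  rw [Finset.sum_congr rfl hw, ← ENNReal.ofReal_sum_of_nonneg (fun k _ => hnn k)]
  have : ∑ k ∈ Finset.Icc 1 (p + 2 - 1), attachProb α m (p + 2) (i + 1) E k = 1 := by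
    unfold attachProb
    rw [Finset.sum_add_distrib, Finset.sum_const, ← Finset.mul_sum, ← Finset.sum_div,
      show p + 2 - 1 = p + 1 from rfl, hS, hc1, hc]
    push_cast
    simp only [Nat.card_Icc, nsmul_eq_mul]
    push_cast [Nat.add_sub_cancel]
    have e1 : (p : ℝ) + 2 - 1 = p + 1 := by ring
    have e2 : (p : ℝ) + 2 - 2 = p := by ring
    have e3 : (i : ℝ) + 1 - 1 = i := by ring
    rw [e1, e2, e3]
    have hp1 : (p : ℝ) + 1 ≠ 0 := by positivity
    by_cases hz : 2 * (m : ℝ) * p + i = 0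
    · rw [hz, div_zero, mul_zero, add_zero]
      have hi0 : (i : ℝ) = 0 := by nlinarith [mul_nonneg (by linarith : (0 : ℝ) ≤ m) hp]
      have hp0 : (p : ℝ) = 0 := by nlinarith [mul_nonneg (by linarith : (0 : ℝ) ≤ m - 1) hp]
      rw [hD, hi0, hp0]
      field_simp
      ring
    · rw [div_self hz]
      field_simp
      rw [hD]
      ring
  rw [this, ENNReal.ofReal_one]

theorem balanced_addEdges {α : ℝ} (hα : 0 < α) (hα1 : α ≤ 1) {m n : ℕ} (hm : 1 ≤ m)
    (hn : 2 ≤ n) {E : Edges} (hE : Balanced m n 0 E) (i : ℕ) :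
    ∀ E' ∈ (addEdges α m n i E).support, Balanced m n i E' := by
  induction i with
  | zero =>
    intro E' h
    simp only [addEdges, PMF.support_pure, Set.mem_singleton_iff] at h
    exact h ▸ hE
  | succ i ih =>
    intro E' h
    simp only [addEdges, PMF.mem_support_bind_iff, PMF.support_map, Set.mem_image] at h
    obtain ⟨F, hF, k, hk, rfl⟩ := h
    have hB := ih F hF
    have hk' : k ∈ Finset.Icc 1 (n - 1) := by
      by_contra hc
      apply (PMF.mem_support_iff _ _).1 hk
      unfold attach
      rw [dif_pos (attachWeight_sum hα hα1 hm hn hB), PMF.ofFinset_apply]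
      exact attachWeight_of_notMem α m n (i + 1) F hc
    obtain ⟨h1, h2, h3⟩ := hB
    have hkn := Finset.mem_Icc.1 hk'
    refine ⟨?_, ?_, ?_⟩
    · have hcg : ∀ a ∈ Finset.Icc 1 (n - 1), degree (s(n, k) ::ₘ F) a
          = degree F a + if a = k then 1 else 0 := by
        intro a ha
        have := Finset.mem_Icc.1 ha
        rw [degree_cons]
        congr 2
        simp only [eq_iff_iff, or_iff_right_iff_imp]
        omega
      rw [Finset.sum_congr rfl hcg, Finset.sum_add_distrib, h1, Finset.sum_ite_eq', if_pos hk']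
      omega
    · rw [degree_cons, h2]; simp
    · intro a ha
      rw [degree_cons, h3 a ha, if_neg (by omega)]

theorem balanced_graphLaw {α : ℝ} (hα : 0 < α) (hα1 : α ≤ 1) {m : ℕ} (hm : 1 ≤ m) (n : ℕ) :
    ∀ E ∈ (graphLaw α m (n + 1)).support, Balanced m (n + 2) 0 E := by
  induction n with
  | zero =>
    intro E h
    simp only [graphLaw, PMF.support_pure, Set.mem_singleton_iff] at h
    subst h
    simp [Balanced, degree]
  | succ n ih =>
    intro E h
    simp only [graphLaw, PMF.mem_support_bind_iff] at h
    obtain ⟨F, hF, hE⟩ := h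
    obtain ⟨h1, h2, h3⟩ := balanced_addEdges hα hα1 hm (by omega) (ih F hF) m E hE
    refine ⟨?_, h3 _ (by omega), fun k hk => h3 k (by omega)⟩
    rw [show n + 1 + 2 - 1 = n + 1 + 1 from rfl, Finset.sum_Icc_succ_top (by omega),
      show n + 1 = n + 2 - 1 from rfl, h1]
    rw [show n + 2 - 1 + 1 = n + 2 from rfl, h2, show n + 2 - 1 + 2 - 2 = n + 1 from rfl,
      show n + 2 - 2 = n from rfl]
    ring

/-- At every configuration reached by the process, the attachment weights are a probability
distribution on `{1, …, n - 1}` (here the new vertex is `n + 2`, and `i` of its edges have been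
attached already). -/
theorem attachWeight_sum_of_mem_support {α : ℝ} (hα : 0 < α) (hα1 : α ≤ 1) {m : ℕ} (hm : 1 ≤ m)
    (n i : ℕ) {E F : Edges} (hE : E ∈ (graphLaw α m (n + 1)).support)
    (hF : F ∈ (addEdges α m (n + 2) i E).support) :
    ∑ k ∈ Finset.Icc 1 (n + 2 - 1), attachWeight α m (n + 2) (i + 1) F k = 1 :=
  attachWeight_sum hα hα1 hm (by omega)
    (balanced_addEdges hα hα1 hm (by omega) (balanced_graphLaw hα hα1 hm n E hE) i F hF)

end PrefAttach

/-! If the probability that a prescribed collection of edges is present were bounded by the product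
of single-edge bounds, a union bound over closed walks through `n` would suffice. For vertices `x ≤
y` the single-edge bound is a constant times `y ^ (-1/2 - δ) * x ^ (δ - 1/2)` with `δ = α / 4`. It
says that a degree grows at most like `t ^ (1/2 - δ)`; the uniform choices push the exponent
strictly below `1/2`.

The product bound (`expect_graphLaw_indicator_le`) needs care, because edges at a common vertex are
positively correlated. One follows the expectation of the indicator of `S ≤ E` times a product of
rising factorials of shifted degrees. Going back through one attachment either multiplies this
expectation by a factor close to one, or removes an edge from `S` and raises the exponent of its
older endpoint by one. The number of edges plus the total exponent never increases, so all constants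
depend on the cycle length only.

For the union bound, `x ^ (-1/2)` is a supersolution of the kernel: applying the kernel multiplies
it by at most `2 / δ` (`sum_edgeKernel_mul_le`). The edge closing the walk costs at most `x ^ (-1/2)
* n ^ (-1/2)`, which supplies that function at the end of the path. Iterating back to `n` leaves `n
^ (-1/2) * n ^ (-1/2) = 1 / n` up to a constant. -/

namespace PrefAttach

/-! ### Expectations with values in `[0, ∞]`. -/

/-- The expectation of a function with values in `[0, ∞]`. -/
noncomputable def expect {β : Type*} (p : PMF β) (f : β → ℝ≥0∞) : ℝ≥0∞ := ∑' a, p a * f a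

section expect

variable {β γ : Type*}

theorem expect_pure (a : β) (f : β → ℝ≥0∞) : expect (PMF.pure a) f = f a := by
  rw [expect, tsum_eq_single a]
  · simp
  · intro b hb
    simp [PMF.pure_apply, hb]

theorem expect_bind (p : PMF β) (g : β → PMF γ) (f : γ → ℝ≥0∞) :
    expect (p.bind g) f = expect p fun a => expect (g a) f := by
  simp only [expect, PMF.bind_apply, ← ENNReal.tsum_mul_left, ← ENNReal.tsum_mul_right]
  rw [ENNReal.tsum_comm]
  simp only [mul_assoc]

theorem expect_map (p : PMF β) (g : β → γ) (f : γ → ℝ≥0∞) :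
    expect (p.map g) f = expect p fun a => f (g a) := by
  rw [← PMF.bind_pure_comp, expect_bind]
  simp only [Function.comp_apply, expect_pure]

theorem expect_mono {p : PMF β} {f g : β → ℝ≥0∞} (h : ∀ a ∈ p.support, f a ≤ g a) :
    expect p f ≤ expect p g := by
  refine ENNReal.tsum_le_tsum fun a => ?_
  by_cases ha : a ∈ p.support
  · exact mul_le_mul_right (h a ha) _
  · rw [PMF.mem_support_iff, not_not] at ha
    simp [ha]

theorem expect_const_mul (p : PMF β) (c : ℝ≥0∞) (f : β → ℝ≥0∞) :
    expect p (fun a => c * f a) = c * expect p f := by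
  simp only [expect, ← ENNReal.tsum_mul_left]
  exact tsum_congr fun a => mul_left_comm _ _ _

theorem expect_add (p : PMF β) (f g : β → ℝ≥0∞) :
    expect p (fun a => f a + g a) = expect p f + expect p g := by
  simp only [expect, mul_add, ENNReal.tsum_add]

theorem expect_sum {ι : Type*} (p : PMF β) (s : Finset ι) (f : ι → β → ℝ≥0∞) :
    expect p (fun a => ∑ i ∈ s, f i a) = ∑ i ∈ s, expect p (f i) := by
  simp only [expect, Finset.mul_sum]
  exact Summable.tsum_finsetSum fun _ _ => ENNReal.summable

theorem expect_eq_zero {p : PMF β} {f : β → ℝ≥0∞} (h : ∀ a ∈ p.support, f a = 0) :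
    expect p f = 0 := by
  refine le_antisymm ((expect_mono (g := fun _ => 0) fun a ha => (h a ha).le).trans ?_) zero_le
  simp [expect]

end expect

/-! ### Degree moments and the attachment of a single edge. -/

/-- A product of rising factorials of the shifted degrees of the vertices `1, …, t`. -/
noncomputable def risingProd (c t : ℕ) (r : ℕ → ℕ) (E : Edges) : ℝ≥0∞ :=
  ∏ x ∈ Finset.Icc 1 t, ((degree E x + c).ascFactorial (r x) : ℝ≥0∞)

open Classical in
/-- The product of rising factorials `risingProd`, restricted to the event that all edges of `S`
are present. -/
noncomputable def moment (c t : ℕ) (S : Edges) (r : ℕ → ℕ) (E : Edges) : ℝ≥0∞ :=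
  if S ≤ E then risingProd c t r E else 0

theorem risingProd_cons {c t k : ℕ} (hk : k ∈ Finset.Icc 1 t) (r : ℕ → ℕ) (E : Edges) :
    risingProd c t r (s(t + 1, k) ::ₘ E) =
      ((degree E k + c + 1).ascFactorial (r k) : ℝ≥0∞) *
        ∏ x ∈ (Finset.Icc 1 t).erase k, ((degree E x + c).ascFactorial (r x) : ℝ≥0∞) := by
  rw [risingProd, ← Finset.mul_prod_erase _ _ hk]
  congr 1
  · rw [degree_cons, if_pos (Or.inr rfl), add_right_comm]
  · refine Finset.prod_congr rfl fun x hx => ?_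
    obtain ⟨h1, h2⟩ := Finset.mem_erase.1 hx
    have := Finset.mem_Icc.1 h2
    rw [degree_cons, if_neg (by omega), add_zero]

/-- Rising factorials are used instead of powers because the degree factor in the attachment
probability and the degree increment combine exactly: `d` times the rising factorial of `d + 1` is
that of `d` with one more factor. -/
theorem risingProd_add_single {c t k : ℕ} (hk : k ∈ Finset.Icc 1 t) (r : ℕ → ℕ) (E : Edges) :
    risingProd c t (r + Pi.single k 1) E = (degree E k + c : ℝ≥0∞) *
      risingProd c t r (s(t + 1, k) ::ₘ E) := by
  rw [risingProd_cons hk, risingProd, ← Finset.mul_prod_erase _ _ hk, ← mul_assoc]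
  congr 1
  · rw [Pi.add_apply, Pi.single_eq_same, Nat.ascFactorial_succ, ← Nat.succ_ascFactorial]
    push_cast
    rfl
  · refine Finset.prod_congr rfl fun x hx => ?_
    rw [Pi.add_apply, Pi.single_eq_of_ne (Finset.mem_erase.1 hx).1, add_zero]

theorem mul_risingProd_cons_le {c t k : ℕ} (hc : 0 < c) (hk : k ∈ Finset.Icc 1 t) (r : ℕ → ℕ)
    (E : Edges) {p b : ℝ≥0∞} (hp : p ≤ b * (degree E k + c)) :
    p * risingProd c t r (s(t + 1, k) ::ₘ E) ≤ (p + b * r k) * risingProd c t r E := by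
  rw [risingProd_cons hk, risingProd, ← Finset.mul_prod_erase _ _ hk, ← mul_assoc, ← mul_assoc]
  refine mul_le_mul_left ?_ _
  set d : ℝ≥0∞ := degree E k + c with hd
  have hd0 : d ≠ 0 := by simp [hd, hc.ne']
  have hdt : d ≠ ⊤ := by simp [hd]
  have key : d * ((degree E k + c + 1).ascFactorial (r k) : ℝ≥0∞)
      = (d + r k) * ((degree E k + c).ascFactorial (r k) : ℝ≥0∞) := by
    rw [hd]
    exact_mod_cast Nat.succ_ascFactorial (degree E k + c) (r k)
  -- Writing `p = u * d` exposes the factor `d` that `key` needs, so that `p` itself survives on the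
  -- right. Summed over `k`, these probabilities give exactly 1.
  obtain ⟨u, rfl⟩ : ∃ u, p = u * d := ⟨p / d, (ENNReal.div_mul_cancel hd0 hdt).symm⟩
  have hu : u ≤ b := (ENNReal.mul_le_mul_iff_left hd0 hdt).1 hp
  rw [mul_assoc, key, ← mul_assoc, mul_add]
  gcongr

/-- If the new edge lies in `S`, only the rest of `S` had to be present before, and its probability
is absorbed by one more factor at `k`. Otherwise `S` was already present, and only the rising
factorial at `k` changes. -/
theorem expect_moment_cons_le {c t : ℕ} (hc : 0 < c) (p : PMF ℕ) (F : Edges) {b : ℝ≥0∞}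
    (hp : ∀ k ∈ Finset.Icc 1 t, p k ≤ b * (degree F k + c))
    (hp0 : ∀ k ∉ Finset.Icc 1 t, p k = 0) (S : Edges) (r : ℕ → ℕ) :
    expect p (fun k => moment c t S r (s(t + 1, k) ::ₘ F)) ≤
      (1 + b * ∑ x ∈ Finset.Icc 1 t, (r x : ℝ≥0∞)) * moment c t S r F +
      ∑ k ∈ Finset.Icc 1 t, if s(t + 1, k) ∈ S then
        b * moment c t (S.erase s(t + 1, k)) (r + Pi.single k 1) F else 0 := by
  have h1 : ∑ k ∈ Finset.Icc 1 t, p k = 1 := by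
    rw [← p.tsum_coe, tsum_eq_sum hp0]
  rw [expect, tsum_eq_sum (s := Finset.Icc 1 t) (fun k hk => by rw [hp0 k hk, zero_mul]), ← h1,
    Finset.mul_sum, ← Finset.sum_add_distrib, Finset.sum_mul, ← Finset.sum_add_distrib]
  refine Finset.sum_le_sum fun k hk => ?_
  by_cases hS : s(t + 1, k) ∈ S
  · rw [if_pos hS]
    refine le_trans ?_ le_add_self
    simp only [moment, ← Multiset.erase_le_iff_le_cons]
    split_ifs
    · rw [risingProd_add_single hk, ← mul_assoc]
      exact mul_le_mul_left (hp k hk) _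
    · simp
  · rw [if_neg hS, add_zero]
    simp only [moment, Multiset.le_cons_of_notMem hS]
    split_ifs
    · exact mul_risingProd_cons_le hc hk r F (hp k hk)
    · simp

/-- Expanding a product over a multiset to first order. -/
theorem prod_map_add_sum_erase_le {ι : Type*} [DecidableEq ι] (S : Multiset ι)
    (f g : ι → ℝ≥0∞) :
    (S.map f).prod + ∑ e ∈ S.toFinset, g e * ((S.erase e).map f).prod
      ≤ (S.map fun e => f e + g e).prod := by
  induction S using Multiset.induction_on with
  | empty => simp
  | cons a S ih =>
    have h : ∑ e ∈ (a ::ₘ S).toFinset, g e * (((a ::ₘ S).erase e).map f).prod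
        ≤ g a * (S.map f).prod + f a * ∑ e ∈ S.toFinset, g e * ((S.erase e).map f).prod := by
      rw [Multiset.toFinset_cons, ← Finset.add_sum_erase _ _ (Finset.mem_insert_self a _),
        Multiset.erase_cons_head, Finset.mul_sum]
      -- A repeated edge contributes only once to the sum over `toFinset`, so dropping `a` from the
      -- tail gives an inequality and not an identity.
      refine add_le_add_right ?_ _
      refine le_trans (Finset.sum_le_sum fun e he => ?_) (Finset.sum_le_sum_of_subset
        (fun e he => Finset.mem_of_mem_insert_of_ne (Finset.mem_erase.1 he).2
          (Finset.mem_erase.1 he).1))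
      rw [Multiset.erase_cons_tail _ (Finset.mem_erase.1 he).1.symm, Multiset.map_cons,
        Multiset.prod_cons, mul_left_comm]
    calc _ ≤ f a * (S.map f).prod + (g a * (S.map f).prod +
          f a * ∑ e ∈ S.toFinset, g e * ((S.erase e).map f).prod) := by
            rw [Multiset.map_cons, Multiset.prod_cons]
            gcongr
      _ ≤ (f a + g a) * ((S.map f).prod + ∑ e ∈ S.toFinset, g e * ((S.erase e).map f).prod) := by
            rw [add_mul, mul_add, mul_add, add_assoc]
            gcongr _ + ?_
            rw [add_comm]
            gcongr
            exact le_self_add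
      _ ≤ _ := by
            rw [Multiset.map_cons, Multiset.prod_cons]
            gcongr

/-! ### Attachment probabilities and the one-step recursion. -/

/-- A bound for the factor by which a vertex of total weight one gains edges when one of the edges
of the vertex `p + 2` is attached. -/
noncomputable def stepRate (α : ℝ) (m p : ℕ) : ℝ := (1 / 2 - α / 4) / (m * (p + α))

/-- The exact slope in the degree is governed by `(1 - α) / 2`, but the matching shift `2 * m * α /
(1 - α)` blows up as `α` tends to 1. The larger exponent `1/2 - α/4` is still below `1/2` and allows
the integer shift `4 * m` for all `α`. -/
theorem attachProb_le {α : ℝ} (hα : 0 < α) (hα1 : α ≤ 1) {m : ℕ} (hm : 1 ≤ m) (p i : ℕ)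
    (F : Edges) (k : ℕ) :
    attachProb α m (p + 2) (i + 1) F k ≤ stepRate α m p * (degree F k + (4 * m : ℕ)) := by
  have hm' : (1 : ℝ) ≤ m := by exact_mod_cast hm
  have hp : (0 : ℝ) ≤ p := Nat.cast_nonneg p
  have hi : (0 : ℝ) ≤ i := Nat.cast_nonneg i
  have hb : 0 ≤ 1 - α := by linarith
  have hd : (0 : ℝ) ≤ degree F k := Nat.cast_nonneg _
  set d : ℝ := (degree F k : ℝ)
  set D : ℝ := 2 * m * p + 2 * m * α + (1 - α) * i with hD
  have hD0 : 0 < 2 * m * (p + α) := by positivity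
  have hDle : 2 * m * (p + α) ≤ D := by
    rw [hD]; nlinarith [mul_nonneg hb hi]
  have hDpos : 0 < D := hD0.trans_le hDle
  have hc : uniformCoeff α m (p + 2) (i + 1) = α * (2 * m * (p + 1) / D) := by
    unfold uniformCoeff
    push_cast
    rw [hD]
    congr 3 <;> ring
  have hc1 : 1 - uniformCoeff α m (p + 2) (i + 1) = (1 - α) * (2 * m * p + i) / D := by
    rw [hc]; field_simp; rw [hD]; ring
  have h1 : attachProb α m (p + 2) (i + 1) F k ≤ ((1 - α) * d + 2 * m * α) / D := by
    unfold attachProb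
    rw [hc1, hc]
    push_cast
    have e1 : (p : ℝ) + 2 - 1 = p + 1 := by ring
    have e2 : (p : ℝ) + 2 - 2 = p := by ring
    have e3 : (i : ℝ) + 1 - 1 = i := by ring
    rw [e1, e2, e3, add_div, add_comm]
    refine add_le_add ?_ (le_of_eq (by field_simp))
    -- The total degree vanishes only for the first edge of vertex 2; the quotient is then 0 by
    -- convention.
    by_cases hz : 2 * (m : ℝ) * p + i = 0
    · rw [hz, div_zero, mul_zero]
      positivity
    · exact le_of_eq (by field_simp; rfl)
  refine h1.trans ((div_le_div_of_nonneg_left (by positivity) hD0 hDle).trans ?_)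
  rw [stepRate, div_mul_eq_mul_div, div_le_div_iff₀ hD0 (by positivity)]
  have hpa : 0 < m * (p + α) := by positivity
  have : (1 - α) * d + 2 * m * α ≤ 2 * ((1 / 2 - α / 4) * (d + 4 * m)) := by
    nlinarith [mul_nonneg hα.le hd, mul_le_mul_of_nonneg_left hα1 (by linarith : (0 : ℝ) ≤ m)]
  push_cast
  calc _ ≤ (2 * ((1 / 2 - α / 4) * (d + 4 * m))) * (m * (p + α)) := by gcongr
    _ = _ := by ring

theorem attach_apply {α : ℝ} (hα : 0 < α) (hα1 : α ≤ 1) {m : ℕ} (hm : 1 ≤ m) {p i : ℕ}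
    {F : Edges} (hF : Balanced m (p + 2) i F) (k : ℕ) :
    attach α m (p + 2) (i + 1) F k = attachWeight α m (p + 2) (i + 1) F k := by
  rw [attach, dif_pos (attachWeight_sum hα hα1 hm (by omega) hF), PMF.ofFinset_apply]

theorem attach_le {α : ℝ} (hα : 0 < α) (hα1 : α ≤ 1) {m : ℕ} (hm : 1 ≤ m) {p i : ℕ}
    {F : Edges} (hF : Balanced m (p + 2) i F) {k : ℕ} (hk : k ∈ Finset.Icc 1 (p + 1)) :
    attach α m (p + 2) (i + 1) F k ≤
      ENNReal.ofReal (stepRate α m p) * (degree F k + (4 * m : ℕ)) := by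
  rw [attach_apply hα hα1 hm hF, attachWeight, if_pos (show k ∈ Finset.Icc 1 (p + 2 - 1) from hk)]
  refine (ENNReal.ofReal_le_ofReal (attachProb_le hα hα1 hm p i F k)).trans (le_of_eq ?_)
  rw [ENNReal.ofReal_mul' (by positivity), ENNReal.ofReal_add (by positivity) (by positivity),
    ENNReal.ofReal_natCast, ENNReal.ofReal_natCast]

theorem attach_eq_zero {α : ℝ} (hα : 0 < α) (hα1 : α ≤ 1) {m : ℕ} (hm : 1 ≤ m) {p i : ℕ}
    {F : Edges} (hF : Balanced m (p + 2) i F) {k : ℕ} (hk : k ∉ Finset.Icc 1 (p + 1)) :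
    attach α m (p + 2) (i + 1) F k = 0 := by
  rw [attach_apply hα hα1 hm hF]
  exact attachWeight_of_notMem _ _ _ _ _ hk

/-- The law of the edges when the vertex `p + 2` has received `i` of its edges. -/
noncomputable def stepLaw (α : ℝ) (m p i : ℕ) : PMF Edges :=
  (graphLaw α m (p + 1)).bind fun E => addEdges α m (p + 2) i E

theorem balanced_stepLaw {α : ℝ} (hα : 0 < α) (hα1 : α ≤ 1) {m : ℕ} (hm : 1 ≤ m) {p i : ℕ}
    {F : Edges} (hF : F ∈ (stepLaw α m p i).support) : Balanced m (p + 2) i F := by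
  rw [stepLaw, PMF.mem_support_bind_iff] at hF
  obtain ⟨E, hE, hF⟩ := hF
  exact balanced_addEdges hα hα1 hm (by omega) (balanced_graphLaw hα hα1 hm p E hE) i F hF

theorem stepLaw_zero (α : ℝ) (m p : ℕ) : stepLaw α m p 0 = graphLaw α m (p + 1) :=
  PMF.bind_pure _

theorem stepLaw_succ (α : ℝ) (m p i : ℕ) :
    stepLaw α m p (i + 1) = (stepLaw α m p i).bind fun F =>
      (attach α m (p + 2) (i + 1) F).map fun k => s(p + 2, k) ::ₘ F := by
  simp only [stepLaw, addEdges, PMF.bind_bind]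

theorem expect_stepLaw_succ_le {α : ℝ} (hα : 0 < α) (hα1 : α ≤ 1) {m : ℕ} (hm : 1 ≤ m)
    (p i : ℕ) (S : Edges) (r : ℕ → ℕ) :
    expect (stepLaw α m p (i + 1)) (moment (4 * m) (p + 1) S r) ≤
      (1 + ENNReal.ofReal (stepRate α m p) * ∑ x ∈ Finset.Icc 1 (p + 1), (r x : ℝ≥0∞)) *
        expect (stepLaw α m p i) (moment (4 * m) (p + 1) S r) +
      ∑ k ∈ Finset.Icc 1 (p + 1), if s(p + 2, k) ∈ S then
        ENNReal.ofReal (stepRate α m p) * expect (stepLaw α m p i)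
          (moment (4 * m) (p + 1) (S.erase s(p + 2, k)) (r + Pi.single k 1)) else 0 := by
  rw [stepLaw_succ, expect_bind]
  simp only [expect_map]
  refine (expect_mono fun F hF => ?_).trans (le_of_eq (?_ : expect _ (fun F =>
    (1 + ENNReal.ofReal (stepRate α m p) * ∑ x ∈ Finset.Icc 1 (p + 1), (r x : ℝ≥0∞)) *
      moment (4 * m) (p + 1) S r F +
    ∑ k ∈ Finset.Icc 1 (p + 1), if s(p + 2, k) ∈ S then ENNReal.ofReal (stepRate α m p) *
      moment (4 * m) (p + 1) (S.erase s(p + 2, k)) (r + Pi.single k 1) F else 0) = _))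
  · have hB := balanced_stepLaw hα hα1 hm hF
    exact expect_moment_cons_le (by omega) _ F (fun k hk => attach_le hα hα1 hm hB hk)
      (fun k hk => attach_eq_zero hα hα1 hm hB hk) S r
  · rw [expect_add, expect_const_mul, expect_sum]
    congr 1
    refine Finset.sum_congr rfl fun k _ => ?_
    split_ifs
    · exact expect_const_mul _ _ _
    · exact expect_eq_zero fun _ _ => rfl

/-! ### Induction along the process: edge probabilities multiply. -/

/-- The growth factor of the product of rising factorials with exponents `r`. -/
noncomputable def growth (M : ℝ≥0∞) (A : ℕ → ℝ≥0∞) (t : ℕ) (a : ℝ≥0∞) (r : ℕ → ℕ) : ℝ≥0∞ :=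
  ∏ x ∈ Finset.Icc 1 t, (M * (a / A x)) ^ r x

theorem growth_add_single {M : ℝ≥0∞} {A : ℕ → ℝ≥0∞} {t k : ℕ} (hk : k ∈ Finset.Icc 1 t)
    (a : ℝ≥0∞) (r : ℕ → ℕ) :
    growth M A t a (r + Pi.single k 1) = M * (a / A k) * growth M A t a r := by
  rw [growth, growth, ← Finset.mul_prod_erase _ _ hk, ← Finset.mul_prod_erase _ _ hk, ← mul_assoc,
    Pi.add_apply, Pi.single_eq_same, pow_succ']
  congr 1
  refine Finset.prod_congr rfl fun x hx => ?_
  rw [Pi.add_apply, Pi.single_eq_of_ne (Finset.mem_erase.1 hx).1, add_zero]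

theorem growth_mono {M : ℝ≥0∞} {A : ℕ → ℝ≥0∞} {t : ℕ} {a a' : ℝ≥0∞} (h : a ≤ a') (r : ℕ → ℕ) :
    growth M A t a r ≤ growth M A t a' r := by
  unfold growth
  gcongr

theorem one_add_mul_le_one_add_pow (b : ℝ≥0∞) (n : ℕ) : 1 + b * n ≤ (1 + b) ^ n := by
  induction n with
  | zero => simp
  | succ n ih =>
    rw [pow_succ]
    calc 1 + b * (n + 1 : ℕ) = (1 + b * n) + 1 * b := by push_cast; ring
      _ ≤ (1 + b) ^ n + (1 + b) ^ n * b := by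
        gcongr
        exact one_le_pow₀ le_self_add
      _ = _ := by ring

theorem one_add_mul_growth_le (M : ℝ≥0∞) (A : ℕ → ℝ≥0∞) (t : ℕ) (a b : ℝ≥0∞) (r : ℕ → ℕ) :
    (1 + b * ∑ x ∈ Finset.Icc 1 t, (r x : ℝ≥0∞)) * growth M A t a r ≤
      growth M A t (a * (1 + b)) r := by
  have : growth M A t (a * (1 + b)) r =
      (1 + b) ^ (∑ x ∈ Finset.Icc 1 t, r x) * growth M A t a r := by
    rw [growth, growth, ← Finset.prod_pow_eq_pow_sum, ← Finset.prod_mul_distrib]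
    refine Finset.prod_congr rfl fun x _ => ?_
    rw [← mul_pow, ENNReal.div_eq_inv_mul, ENNReal.div_eq_inv_mul]
    ring
  rw [this]
  gcongr
  exact_mod_cast one_add_mul_le_one_add_pow b (∑ x ∈ Finset.Icc 1 t, r x)

/-- The weights of the edges of a configuration when the vertex `n` has received `i` of its `m`
edges: an edge at `n` is one of these `i` edges. -/
noncomputable def partialWeight (m n i : ℕ) (q : Sym2 ℕ → ℝ≥0∞) (e : Sym2 ℕ) : ℝ≥0∞ :=
  if n ∈ e then i * q e else m * q e

theorem prod_partialWeight_add_le (m n i t : ℕ) (q : Sym2 ℕ → ℝ≥0∞) (S : Edges) :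
    (S.map (partialWeight m n i q)).prod + (∑ k ∈ Finset.Icc 1 t, if s(n, k) ∈ S then
      q s(n, k) * ((S.erase s(n, k)).map (partialWeight m n i q)).prod else 0) ≤
    (S.map (partialWeight m n (i + 1) q)).prod := by
  have h : partialWeight m n (i + 1) q =
      fun e => partialWeight m n i q e + if n ∈ e then q e else 0 := by
    funext e
    unfold partialWeight
    split_ifs
    · push_cast; ring
    · simp
  rw [h]
  refine le_trans (add_le_add_right ?_ _) (prod_map_add_sum_erase_le S _ _)
  rw [← Finset.sum_filter]
  have hinj : Set.InjOn (fun k => s(n, k)) ((Finset.Icc 1 t).filter fun k => s(n, k) ∈ S) :=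
    fun a _ b _ hab => Sym2.congr_right.1 hab
  calc _ = ∑ k ∈ (Finset.Icc 1 t).filter (fun k => s(n, k) ∈ S), (fun e => (if n ∈ e then q e else 0)
        * ((S.erase e).map (partialWeight m n i q)).prod) s(n, k) :=
        Finset.sum_congr rfl fun k _ => by simp
    _ = ∑ e ∈ ((Finset.Icc 1 t).filter fun k => s(n, k) ∈ S).image fun k => s(n, k),
          (if n ∈ e then q e else 0) * ((S.erase e).map (partialWeight m n i q)).prod :=
        (Finset.sum_image (f := fun e => (if n ∈ e then q e else 0) *
          ((S.erase e).map (partialWeight m n i q)).prod) hinj).symm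
    _ ≤ _ := Finset.sum_le_sum_of_subset fun e he => by
        obtain ⟨k, hk, rfl⟩ := Finset.mem_image.1 he
        exact Multiset.mem_toFinset.2 (Finset.mem_filter.1 hk).2

/-- The hypotheses on the growth rate `A` and the edge weights `q` under which `q` bounds the
probabilities of edges. -/
structure Dominates (α : ℝ) (m : ℕ) (M : ℝ≥0∞) (A : ℕ → ℝ≥0∞) (q : Sym2 ℕ → ℝ≥0∞) : Prop where
  ne_zero : ∀ t, 1 ≤ t → A t ≠ 0
  ne_top : ∀ t, A t ≠ ⊤
  growth : ∀ p, A (p + 1) * (1 + ENNReal.ofReal (stepRate α m p)) ^ m ≤ A (p + 2)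
  edge : ∀ p, ∀ u ∈ Finset.Icc 1 (p + 1),
    ENNReal.ofReal (stepRate α m p) * (M * (A (p + 2) / A u)) ≤ q s(p + 2, u)

theorem expect_stepLaw_le {α : ℝ} (hα : 0 < α) (hα1 : α ≤ 1) {m : ℕ} (hm : 1 ≤ m) {M : ℝ≥0∞}
    {A : ℕ → ℝ≥0∞} {q : Sym2 ℕ → ℝ≥0∞} (hd : Dominates α m M A q) (L p : ℕ)
    (h0 : ∀ (S : Edges) (r : ℕ → ℕ), S.card + ∑ x ∈ Finset.Icc 1 (p + 1), r x ≤ L →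
      expect (graphLaw α m (p + 1)) (moment (4 * m) (p + 1) S r) ≤
        (S.map fun e => m * q e).prod * growth M A (p + 1) (A (p + 1)) r)
    (i : ℕ) (hi : i ≤ m) (S : Edges) (r : ℕ → ℕ)
    (hL : S.card + ∑ x ∈ Finset.Icc 1 (p + 1), r x ≤ L) :
    expect (stepLaw α m p i) (moment (4 * m) (p + 1) S r) ≤
      (S.map (partialWeight m (p + 2) i q)).prod *
        growth M A (p + 1) (A (p + 1) * (1 + ENNReal.ofReal (stepRate α m p)) ^ i) r := by
  induction i generalizing S r with
  | zero =>
    rw [pow_zero, mul_one]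
    -- Before its first edge the new vertex has degree 0, so an `S` with an edge there is
    -- impossible. For any other `S` no edge is affected by the partial weights.
    by_cases hS : ∃ e ∈ S, p + 2 ∈ e
    · obtain ⟨e, he, hpe⟩ := hS
      rw [expect_eq_zero]
      · exact zero_le
      · intro F hF
        have hdeg : degree F (p + 2) = 0 := (balanced_stepLaw hα hα1 hm hF).2.1
        rw [moment, if_neg]
        intro hSF
        exact Multiset.countP_eq_zero.1 hdeg e (Multiset.mem_of_le hSF he) hpe
    · push Not at hS
      have hw : S.map (partialWeight m (p + 2) 0 q) = S.map fun e => m * q e :=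
        Multiset.map_congr rfl fun e he => if_neg (hS e he)
      rw [stepLaw_zero, hw]
      exact h0 S r hL
  | succ i ih =>
    set b := ENNReal.ofReal (stepRate α m p) with hb
    set a := A (p + 1) * (1 + b) ^ i with ha
    -- Midway through the step the growth level lies between `A (p + 1)` and `A (p + 2)`, so the
    -- edge bound of `Dominates` applies to each of the `m` attachments.
    have ha2 : a ≤ A (p + 2) := by
      refine le_trans ?_ (hd.growth p)
      rw [ha]
      gcongr
      · exact le_self_add
      · omega
    rw [pow_succ, ← mul_assoc, ← ha]
    refine (expect_stepLaw_succ_le hα hα1 hm p i S r).trans ?_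
    refine le_trans ?_ (mul_le_mul_left (prod_partialWeight_add_le m (p + 2) i (p + 1) q S) _)
    rw [add_mul (Multiset.prod _), Finset.sum_mul]
    refine add_le_add ?_ (Finset.sum_le_sum fun k hk => ?_)
    · calc _ ≤ (1 + b * ∑ x ∈ Finset.Icc 1 (p + 1), (r x : ℝ≥0∞)) *
            ((S.map (partialWeight m (p + 2) i q)).prod * growth M A (p + 1) a r) := by
            gcongr
            exact ih (by omega) S r hL
        _ ≤ _ := by
            rw [mul_left_comm]
            gcongr
            exact one_add_mul_growth_le M A (p + 1) a b r
    · split_ifs with hS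
      -- One edge is traded for one exponent, so the budget `L` is unchanged.
      · have hcard : (S.erase s(p + 2, k)).card +
            ∑ x ∈ Finset.Icc 1 (p + 1), (r + Pi.single k 1 : ℕ → ℕ) x ≤ L := by
          have h1 := Multiset.card_erase_add_one hS
          have h2 : ∑ x ∈ Finset.Icc 1 (p + 1), (Pi.single k 1 : ℕ → ℕ) x = 1 := by
            rw [Finset.sum_pi_single', if_pos hk]
          simp only [Pi.add_apply, Finset.sum_add_distrib, h2]
          omega
        calc _ ≤ b * (((S.erase s(p + 2, k)).map (partialWeight m (p + 2) i q)).prod *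
              growth M A (p + 1) a (r + Pi.single k 1)) := by
              gcongr
              exact ih (by omega) _ _ hcard
          _ = b * (M * (a / A k)) * ((S.erase s(p + 2, k)).map (partialWeight m (p + 2) i q)).prod *
              growth M A (p + 1) a r := by
              rw [growth_add_single hk]; ring
          _ ≤ q s(p + 2, k) * ((S.erase s(p + 2, k)).map (partialWeight m (p + 2) i q)).prod *
              growth M A (p + 1) (a * (1 + b)) r := by
              gcongr
              · exact le_trans (by gcongr) (hd.edge p k hk)
              · exact growth_mono (le_mul_of_one_le_right' le_self_add) r
      · simp

/-- This fixes the constant `5 * m + L`: a vertex enters the moments with degree at most `m`, and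
`L` bounds every exponent that can occur. -/
theorem ascFactorial_le {m d r L : ℕ} (hd : d ≤ m) (hr : r ≤ L) :
    (d + 4 * m).ascFactorial r ≤ (5 * m + L) ^ r := by
  calc (d + 4 * m).ascFactorial r ≤ (d + 4 * m + 1).ascFactorial r :=
        Nat.ascFactorial_le r (Nat.le_succ _)
    _ ≤ (d + 4 * m + r) ^ r := Nat.ascFactorial_le_pow_add _ _
    _ ≤ _ := Nat.pow_le_pow_left (by omega) r

theorem growth_succ {M : ℝ≥0∞} {A : ℕ → ℝ≥0∞} {t : ℕ} (h0 : A (t + 1) ≠ 0) (h1 : A (t + 1) ≠ ⊤)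
    (r : ℕ → ℕ) :
    growth M A (t + 1) (A (t + 1)) r = M ^ r (t + 1) * growth M A t (A (t + 1)) r := by
  rw [growth, Finset.prod_Icc_succ_top (by omega), ENNReal.div_self h0 h1, mul_one, mul_comm]
  rfl

theorem expect_graphLaw_le {α : ℝ} (hα : 0 < α) (hα1 : α ≤ 1) {m : ℕ} (hm : 1 ≤ m) (L : ℕ)
    {A : ℕ → ℝ≥0∞} {q : Sym2 ℕ → ℝ≥0∞} (hd : Dominates α m (5 * m + L : ℕ) A q) (p : ℕ)
    (S : Edges) (r : ℕ → ℕ) (hL : S.card + ∑ x ∈ Finset.Icc 1 (p + 1), r x ≤ L) :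
    expect (graphLaw α m (p + 1)) (moment (4 * m) (p + 1) S r) ≤
      (S.map fun e => m * q e).prod * growth (5 * m + L : ℕ) A (p + 1) (A (p + 1)) r := by
  induction p generalizing S r with
  | zero =>
    rw [graphLaw, expect_pure, moment]
    split_ifs with hS
    · obtain rfl : S = 0 := le_antisymm hS (Multiset.zero_le _)
      rw [growth_succ (hd.ne_zero _ le_rfl) (hd.ne_top _)]
      simp only [risingProd, growth, degree, zero_add, Finset.Icc_self, Finset.prod_singleton,
        Multiset.countP_zero, Multiset.map_zero, Multiset.prod_zero, one_mul]
      simp only [zero_add, Finset.Icc_self, Finset.sum_singleton, Multiset.card_zero] at hL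
      have := ascFactorial_le (m := m) (Nat.zero_le m) hL
      rw [zero_add] at this
      simpa using (by exact_mod_cast this :
        (((4 * m).ascFactorial (r 1) : ℕ) : ℝ≥0∞) ≤ ((5 * m + L : ℕ) : ℝ≥0∞) ^ r 1)
    · exact zero_le
  | succ p ih =>
    rw [Finset.sum_Icc_succ_top (by omega)] at hL
    set M : ℝ≥0∞ := ((5 * m + L : ℕ) : ℝ≥0∞) with hM
    have hlaw : graphLaw α m (p + 1 + 1) = stepLaw α m p m := rfl
    rw [hlaw, growth_succ (hd.ne_zero _ (by omega)) (hd.ne_top _)]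
    -- After its `m` edges the vertex `p + 2` has degree exactly `m`, so its factor is bounded
    -- deterministically and leaves the expectation.
    have h1 : expect (stepLaw α m p m) (moment (4 * m) (p + 1 + 1) S r) ≤
        M ^ r (p + 2) * expect (stepLaw α m p m) (moment (4 * m) (p + 1) S r) := by
      rw [← expect_const_mul]
      refine expect_mono fun F hF => ?_
      simp only [moment]
      split_ifs
      · rw [risingProd, Finset.prod_Icc_succ_top (by omega), mul_comm]
        refine mul_le_mul_left ?_ _
        rw [hM]
        exact_mod_cast ascFactorial_le (balanced_stepLaw hα hα1 hm hF).2.1.le (by omega)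
      · simp
    refine h1.trans ?_
    rw [mul_left_comm]
    refine mul_le_mul_right ?_ _
    refine (expect_stepLaw_le hα hα1 hm hd L p ih m le_rfl S r (by omega)).trans ?_
    have hw : partialWeight m (p + 2) m q = fun e => m * q e := by
      funext e
      simp [partialWeight]
    rw [hw]
    exact mul_le_mul_right (growth_mono (hd.growth p) r) _

/-- The probability that all edges of `S` are present is at most the product of their weights. -/
theorem expect_graphLaw_indicator_le {α : ℝ} (hα : 0 < α) (hα1 : α ≤ 1) {m : ℕ} (hm : 1 ≤ m)
    {A : ℕ → ℝ≥0∞} {q : Sym2 ℕ → ℝ≥0∞} (S : Edges)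
    (hd : Dominates α m (5 * m + S.card : ℕ) A q) (p : ℕ) :
    expect (graphLaw α m (p + 1)) (Set.indicator {E | S ≤ E} 1) ≤
      (S.map fun e => m * q e).prod := by
  have h := expect_graphLaw_le hα hα1 hm S.card hd p S 0 (by simp)
  have hg : growth (5 * m + S.card : ℕ) A (p + 1) (A (p + 1)) 0 = 1 := by simp [growth]
  rw [hg, mul_one] at h
  refine le_trans (expect_mono fun E _ => ?_) h
  simp [Set.indicator, moment, risingProd]

/-! ### The edge kernel and its sums over closed walks. -/

/-- Up to a constant, the probability that two vertices are adjacent. -/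
noncomputable def edgeKernel (p : ℝ) (e : Sym2 ℕ) : ℝ :=
  (e.sup : ℝ) ^ (-(1 / 2) - p) * (e.inf : ℝ) ^ (p - 1 / 2)

theorem edgeKernel_nonneg (p : ℝ) (e : Sym2 ℕ) : 0 ≤ edgeKernel p e := by
  unfold edgeKernel
  positivity

theorem edgeKernel_of_le (p : ℝ) {x y : ℕ} (h : x ≤ y) :
    edgeKernel p s(x, y) = (y : ℝ) ^ (-(1 / 2) - p) * (x : ℝ) ^ (p - 1 / 2) := by
  rw [edgeKernel, Sym2.sup_mk, Sym2.inf_mk, sup_eq_right.2 h, inf_eq_left.2 h]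

theorem edgeKernel_le {p : ℝ} (hp : 0 < p) (hp1 : p < 1 / 2) (x y : ℕ) :
    edgeKernel p s(x, y) ≤ (x : ℝ) ^ (-(1 / 2) : ℝ) * (y : ℝ) ^ (-(1 / 2) : ℝ) := by
  wlog h : x ≤ y generalizing x y
  · rw [Sym2.eq_swap, mul_comm]
    exact this y x (by omega)
  rw [edgeKernel_of_le p h]
  rcases Nat.eq_zero_or_pos x with rfl | hx
  · rw [Nat.cast_zero, Real.zero_rpow (by linarith), Real.zero_rpow (by norm_num)]
    simp
  have hx' : (0 : ℝ) < x := by exact_mod_cast hx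
  have hy' : (0 : ℝ) < y := by exact_mod_cast hx.trans_le h
  rw [sub_eq_add_neg, Real.rpow_add hy', sub_eq_add_neg, Real.rpow_add hx', mul_assoc,
    mul_comm (_ ^ _ : ℝ), ← mul_assoc]
  refine mul_le_mul_of_nonneg_right ?_ (by positivity)
  refine mul_le_of_le_one_left (by positivity) ?_
  rw [Real.rpow_neg hy'.le, inv_mul_le_iff₀ (by positivity), mul_one]
  exact Real.rpow_le_rpow hx'.le (by exact_mod_cast h) hp.le

theorem mul_rpow_sub_one_le {p : ℝ} (hp : 0 < p) (hp1 : p ≤ 1) (u : ℕ) :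
    p * ((u + 1 : ℕ) : ℝ) ^ (p - 1) ≤ ((u + 1 : ℕ) : ℝ) ^ p - (u : ℝ) ^ p := by
  set x : ℝ := ((u + 1 : ℕ) : ℝ) with hx
  have hx1 : 1 ≤ x := by rw [hx]; exact_mod_cast Nat.le_add_left 1 u
  have hx0 : 0 < x := by linarith
  have hinv : x⁻¹ ≤ 1 := inv_le_one_of_one_le₀ hx1
  have hu : (u : ℝ) = x * (1 + -x⁻¹) := by
    rw [mul_add, mul_neg, mul_inv_cancel₀ hx0.ne', hx]; push_cast; ring
  have h := rpow_one_add_le_one_add_mul_self (s := -x⁻¹) (by linarith) hp.le hp1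
  rw [hu, Real.mul_rpow hx0.le (by linarith), Real.rpow_sub_one hx0.ne', div_eq_mul_inv]
  have := mul_le_mul_of_nonneg_left h (Real.rpow_nonneg hx0.le p)
  linarith

theorem mul_rpow_neg_sub_one_le {p : ℝ} (hp : 0 < p) {u : ℕ} (hu0 : 1 ≤ u) :
    p * ((u + 1 : ℕ) : ℝ) ^ (-p - 1) ≤ (u : ℝ) ^ (-p) - ((u + 1 : ℕ) : ℝ) ^ (-p) := by
  set x : ℝ := ((u + 1 : ℕ) : ℝ) with hx
  have hx1 : 2 ≤ x := by rw [hx]; exact_mod_cast Nat.add_le_add_right hu0 1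
  have hx0 : 0 < x := by linarith
  have hinv : x⁻¹ ≤ 1 / 2 := by
    rw [one_div]; exact inv_anti₀ (by norm_num) hx1
  have hpos : 0 < 1 - x⁻¹ := by linarith
  have hu : (u : ℝ) = x * (1 - x⁻¹) := by
    rw [mul_sub, mul_inv_cancel₀ hx0.ne', hx]; push_cast; ring
  -- For the negative exponent, Bernoulli's inequality comes from `log (1 - s) ≤ -s` and `1 + t ≤
  -- exp t`.
  have h : 1 + p * x⁻¹ ≤ (1 - x⁻¹) ^ (-p) := by
    rw [Real.rpow_def_of_pos hpos]
    have h1 := Real.log_le_sub_one_of_pos hpos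
    have h2 := Real.add_one_le_exp (Real.log (1 - x⁻¹) * -p)
    nlinarith
  rw [hu, Real.mul_rpow hx0.le hpos.le, Real.rpow_sub_one hx0.ne', div_eq_mul_inv]
  have := mul_le_mul_of_nonneg_left h (Real.rpow_nonneg hx0.le (-p))
  linarith

theorem sum_rpow_sub_one_le {p : ℝ} (hp : 0 < p) (hp1 : p < 1) (u : ℕ) :
    p * ∑ x ∈ Finset.range (u + 1), (x : ℝ) ^ (p - 1) ≤ (u : ℝ) ^ p := by
  induction u with
  | zero => simp [Real.zero_rpow hp.ne', Real.zero_rpow (by linarith : p - 1 ≠ 0)]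
  | succ u ih =>
    rw [Finset.sum_range_succ, mul_add]
    linarith [mul_rpow_sub_one_le hp hp1.le u]

theorem sum_rpow_neg_sub_one_le {p : ℝ} (hp : 0 < p) {u : ℕ} (hu : 1 ≤ u) {N : ℕ} (hN : u ≤ N) :
    p * ∑ x ∈ Finset.Ico (u + 1) (N + 1), (x : ℝ) ^ (-p - 1) ≤
      (u : ℝ) ^ (-p) - (N : ℝ) ^ (-p) := by
  induction N, hN using Nat.le_induction with
  | base => simp
  | succ N hN ih =>
    rw [Finset.sum_Ico_succ_top (by omega), mul_add]
    linarith [mul_rpow_neg_sub_one_le hp (hu.trans hN)]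

/-- Below `u` the summand is a multiple of `x ^ (p - 1)`, above `u` of `x ^ (-p - 1)`. Both sums
telescope to a power of `u` over `p`, and each half contributes `u ^ (-1/2) / p`; this is where `p >
0` is essential. -/
theorem sum_edgeKernel_mul_le {p : ℝ} (hp : 0 < p) (hp1 : p < 1 / 2) {u N : ℕ} (hu : u ≤ N) :
    ∑ x ∈ Finset.range (N + 1), edgeKernel p s(u, x) * (x : ℝ) ^ (-(1 / 2) : ℝ) ≤
      2 / p * (u : ℝ) ^ (-(1 / 2) : ℝ) := by
  -- The label 0 is no vertex of the graph; it is harmless because `0` to a nonzero real power is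
  -- `0`.
  rcases Nat.eq_zero_or_pos u with rfl | hu0
  · refine (Finset.sum_nonpos fun x _ => le_of_eq ?_).trans (by positivity)
    rw [edgeKernel_of_le p (Nat.zero_le x), Nat.cast_zero, Real.zero_rpow (by linarith)]
    simp
  have hu' : (0 : ℝ) < u := by exact_mod_cast hu0
  have h1 : ∑ x ∈ Finset.range (u + 1), edgeKernel p s(u, x) * (x : ℝ) ^ (-(1 / 2) : ℝ) =
      (u : ℝ) ^ (-(1 / 2) - p) * ∑ x ∈ Finset.range (u + 1), (x : ℝ) ^ (p - 1) := by
    rw [Finset.mul_sum]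
    refine Finset.sum_congr rfl fun x hx => ?_
    rw [Sym2.eq_swap, edgeKernel_of_le p (by simpa [Nat.lt_succ_iff] using hx), mul_assoc]
    rcases Nat.eq_zero_or_pos x with rfl | hx0
    · simp [Real.zero_rpow (by linarith : p - 1 ≠ 0)]
    · rw [← Real.rpow_add (by exact_mod_cast hx0)]
      congr 2
      ring
  have h2 : ∑ x ∈ Finset.Ico (u + 1) (N + 1), edgeKernel p s(u, x) * (x : ℝ) ^ (-(1 / 2) : ℝ) =
      (u : ℝ) ^ (p - 1 / 2) * ∑ x ∈ Finset.Ico (u + 1) (N + 1), (x : ℝ) ^ (-p - 1) := by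
    rw [Finset.mul_sum]
    refine Finset.sum_congr rfl fun x hx => ?_
    have hx := Finset.mem_Ico.1 hx
    rw [edgeKernel_of_le p (by omega), mul_right_comm, mul_comm,
      ← Real.rpow_add (by exact_mod_cast (by omega : 0 < x))]
    congr 2
    ring
  rw [← Finset.sum_range_add_sum_Ico _ (by omega : u + 1 ≤ N + 1), h1, h2]
  have e1 : (u : ℝ) ^ (-(1 / 2) - p) * (u : ℝ) ^ p = (u : ℝ) ^ (-(1 / 2) : ℝ) := by
    rw [← Real.rpow_add hu']; congr 1; ring
  have e2 : (u : ℝ) ^ (p - 1 / 2) * (u : ℝ) ^ (-p) = (u : ℝ) ^ (-(1 / 2) : ℝ) := by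
    rw [← Real.rpow_add hu']; congr 1; ring
  have b1 := mul_le_mul_of_nonneg_left (sum_rpow_sub_one_le hp (by linarith) u)
    (Real.rpow_nonneg hu'.le (-(1 / 2) - p))
  have b2 := mul_le_mul_of_nonneg_left ((sum_rpow_neg_sub_one_le hp hu0 hu).trans
    (sub_le_self _ (Real.rpow_nonneg (Nat.cast_nonneg N) (-p))))
    (Real.rpow_nonneg hu'.le (p - 1 / 2))
  rw [e1] at b1
  rw [e2] at b2
  rw [div_mul_eq_mul_div, le_div_iff₀ hp]
  linarith

/-- If `h` is a supersolution for the kernel `κ`, then the sum of `h` over the end points of the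
paths of length `L` from `u` is controlled. -/
theorem sum_paths_le {V : Type*} [Fintype V] {κ : V → V → ℝ} (hκ : ∀ u x, 0 ≤ κ u x) {h : V → ℝ}
    {C : ℝ} (hC : 0 ≤ C) (hs : ∀ u, ∑ x, κ u x * h x ≤ C * h u) (L : ℕ) (u : V) :
    ∑ v : Fin L → V, (∏ i : Fin L, κ ((Fin.cons u v : Fin (L + 1) → V) i.castSucc)
        ((Fin.cons u v : Fin (L + 1) → V) i.succ)) *
      h ((Fin.cons u v : Fin (L + 1) → V) (Fin.last L)) ≤ C ^ L * h u := by
  induction L generalizing u with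
  | zero => simp
  | succ L ih =>
    rw [← (Fin.consEquiv fun _ : Fin (L + 1) => V).sum_comp, Fintype.sum_prod_type]
    calc _ = ∑ x, κ u x * ∑ v : Fin L → V,
          (∏ i : Fin L, κ ((Fin.cons x v : Fin (L + 1) → V) i.castSucc)
            ((Fin.cons x v : Fin (L + 1) → V) i.succ)) *
          h ((Fin.cons x v : Fin (L + 1) → V) (Fin.last L)) := by
          refine Finset.sum_congr rfl fun x _ => ?_
          rw [Finset.mul_sum]
          refine Finset.sum_congr rfl fun v _ => ?_
          rw [Fin.prod_univ_succ, mul_assoc]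
          rfl
      _ ≤ ∑ x, κ u x * (C ^ L * h x) :=
          Finset.sum_le_sum fun x _ => mul_le_mul_of_nonneg_left (ih x) (hκ u x)
      _ = C ^ L * ∑ x, κ u x * h x := by
          rw [Finset.mul_sum]
          exact Finset.sum_congr rfl fun x _ => mul_left_comm _ _ _
      _ ≤ C ^ L * (C * h u) := mul_le_mul_of_nonneg_left (hs u) (pow_nonneg hC L)
      _ = _ := by ring

/-- The edge returning to `N` is split off and bounded by `edgeKernel_le`; its factor at the other
endpoint is the weight required by `sum_paths_le`. -/
theorem sum_closed_paths_le {p : ℝ} (hp : 0 < p) (hp1 : p < 1 / 2) (L N : ℕ) :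
    ∑ v : Fin L → Fin (N + 1), ∏ i : Fin (L + 1), edgeKernel p
        s(((Fin.cons (Fin.last N) v : Fin (L + 1) → Fin (N + 1)) i : ℕ),
          ((Fin.cons (Fin.last N) v : Fin (L + 1) → Fin (N + 1)) (finRotate _ i) : ℕ)) ≤
      (2 / p) ^ L * ((N : ℝ) ^ (-(1 / 2) : ℝ) * (N : ℝ) ^ (-(1 / 2) : ℝ)) := by
  have hs : ∀ u : Fin (N + 1), ∑ x : Fin (N + 1), edgeKernel p s((u : ℕ), (x : ℕ)) *
      ((x : ℕ) : ℝ) ^ (-(1 / 2) : ℝ) ≤ 2 / p * ((u : ℕ) : ℝ) ^ (-(1 / 2) : ℝ) := by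
    intro u
    rw [Fin.sum_univ_eq_sum_range
      (fun x : ℕ => edgeKernel p s((u : ℕ), x) * (x : ℝ) ^ (-(1 / 2) : ℝ)) (N + 1)]
    exact sum_edgeKernel_mul_le hp hp1 (Nat.lt_succ_iff.1 u.2)
  have h := sum_paths_le (κ := fun u x : Fin (N + 1) => edgeKernel p s((u : ℕ), (x : ℕ)))
    (h := fun x : Fin (N + 1) => ((x : ℕ) : ℝ) ^ (-(1 / 2) : ℝ))
    (fun _ _ => edgeKernel_nonneg _ _) (by positivity : 0 ≤ 2 / p) hs L (Fin.last N)
  rw [← mul_assoc]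
  refine le_trans ?_ (mul_le_mul_of_nonneg_right h
    (Real.rpow_nonneg (Nat.cast_nonneg N) (-(1 / 2) : ℝ)))
  rw [Finset.sum_mul]
  refine Finset.sum_le_sum fun v _ => ?_
  rw [Fin.prod_univ_castSucc, mul_assoc]
  have hr : ∀ i : Fin L, finRotate (L + 1) i.castSucc = i.succ := fun i => by
    rw [finRotate_apply, Fin.coeSucc_eq_succ]
  simp only [hr, finRotate_last]
  refine mul_le_mul_of_nonneg_left ?_ (Finset.prod_nonneg fun _ _ => edgeKernel_nonneg _ _)
  simpa using edgeKernel_le hp hp1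
    ((Fin.cons (Fin.last N) v : Fin (L + 1) → Fin (N + 1)) (Fin.last L)) N

/-! ### The growth rate of degrees, and the kernel as a dominating weight. -/

theorem one_add_stepRate_pow_le {α : ℝ} (hα : 0 < α) (hα1 : α ≤ 1) {m : ℕ} (hm : 1 ≤ m) (p : ℕ) :
    (1 + stepRate α m p) ^ m ≤ Real.exp ((1 / 2 - α / 4) / (p + α)) := by
  have hm' : (0 : ℝ) < m := by exact_mod_cast hm
  have hpa : (0 : ℝ) < p + α := by positivity
  have h : (1 / 2 - α / 4) / (p + α) = m * stepRate α m p := by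
    rw [stepRate]; field_simp
  rw [h, Real.exp_nat_mul]
  have h0 : 0 ≤ stepRate α m p := div_nonneg (by linarith) (by positivity)
  exact pow_le_pow_left₀ (by linarith) (by linarith [Real.add_one_le_exp (stepRate α m p)]) m

/-- The growth rate of the degrees; the exponential factor corrects for small `t`. -/
noncomputable def degreeRate (α : ℝ) (t : ℕ) : ℝ :=
  (t : ℝ) ^ (1 / 2 - α / 4) * Real.exp (-(1 / α) / t)

theorem degreeRate_pos (α : ℝ) {t : ℕ} (ht : 1 ≤ t) : 0 < degreeRate α t := by
  have : (0 : ℝ) < t := by exact_mod_cast ht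
  unfold degreeRate
  positivity

theorem degreeRate_mul_le {α : ℝ} (hα : 0 < α) (hα1 : α ≤ 1) {m : ℕ} (hm : 1 ≤ m) (p : ℕ) :
    degreeRate α (p + 1) * (1 + stepRate α m p) ^ m ≤ degreeRate α (p + 2) := by
  refine (mul_le_mul_of_nonneg_left (one_add_stepRate_pow_le hα hα1 hm p)
    (degreeRate_pos α (by omega)).le).trans ?_
  have hp : (0 : ℝ) ≤ p := Nat.cast_nonneg p
  have h1 : (0 : ℝ) < p + 1 := by positivity
  have h2 : (0 : ℝ) < p + 2 := by positivity
  unfold degreeRate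
  push_cast
  rw [Real.rpow_def_of_pos h1, Real.rpow_def_of_pos h2, ← Real.exp_add, ← Real.exp_add,
    ← Real.exp_add, Real.exp_le_exp]
  have hlog : 1 / ((p : ℝ) + 2) ≤ Real.log (p + 2) - Real.log (p + 1) := by
    rw [← Real.log_div h2.ne' h1.ne']
    refine le_trans (le_of_eq ?_) (Real.one_sub_inv_le_log_of_pos (div_pos h2 h1))
    field_simp
    ring
  have hχ : 0 ≤ 1 / 2 - α / 4 := by linarith
  have hmul := mul_le_mul_of_nonneg_left hlog hχ
  -- Replacing `p + α` by `p + 2` costs `(1/2 - α/4) * (2 - α) / ((p + α) * (p + 2))`. Its numerator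
  -- is at most 1 and `p + α ≥ α * (p + 1)`, so the telescoping term with coefficient `1 / α` pays
  -- for it.
  have key : (1 / 2 - α / 4) / (p + α) ≤ (1 / 2 - α / 4) * (1 / ((p : ℝ) + 2)) +
      ((1 / α) / (p + 1) - (1 / α) / (p + 2)) := by
    have e : (1 / 2 - α / 4) / (p + α) - (1 / 2 - α / 4) * (1 / ((p : ℝ) + 2)) =
        ((1 / 2 - α / 4) * (2 - α)) / ((p + α) * (p + 2)) := by
      field_simp
      ring
    have e' : (1 / α) / (p + 1) - (1 / α) / (p + 2) = 1 / ((α * (p + 1)) * (p + 2)) := by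
      field_simp
      ring
    have hle : α * (p + 1) ≤ p + α := by nlinarith
    have : ((1 / 2 - α / 4) * (2 - α)) / ((p + α) * (p + 2)) ≤
        1 / ((α * (p + 1)) * (p + 2)) := by
      refine div_le_div₀ zero_le_one ?_ (by positivity) (by gcongr)
      nlinarith
    linarith
  have n1 : -(1 / α) / ((p : ℝ) + 1) = -((1 / α) / (p + 1)) := neg_div _ _
  have n2 : -(1 / α) / ((p : ℝ) + 2) = -((1 / α) / (p + 2)) := neg_div _ _
  rw [n1, n2]
  nlinarith

/-- The step rate is of order `1 / (p + 2)` and the growth ratio of order `((p + 2) / u) ^ (1/2 -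
α/4)`; their product is the kernel with parameter `α / 4`. The correction factors in `degreeRate`
cost at most `exp (1 / α)`. -/
theorem stepRate_mul_le {α : ℝ} (hα : 0 < α) (hα1 : α ≤ 1) {m : ℕ} (hm : 1 ≤ m) {M : ℝ}
    (hM : 0 ≤ M) {p u : ℕ} (hu : u ∈ Finset.Icc 1 (p + 1)) :
    stepRate α m p * (M * (degreeRate α (p + 2) / degreeRate α u)) ≤
      M * (1 / α) * Real.exp (1 / α) * edgeKernel (α / 4) s(p + 2, u) := by
  obtain ⟨hu1, hu2⟩ := Finset.mem_Icc.1 hu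
  have hp : (0 : ℝ) ≤ p := Nat.cast_nonneg p
  have h2 : (0 : ℝ) < p + 2 := by positivity
  have hu1' : (1 : ℝ) ≤ u := by exact_mod_cast hu1
  have hu0 : (0 : ℝ) < u := by linarith
  have hm' : (1 : ℝ) ≤ m := by exact_mod_cast hm
  have hpa : (0 : ℝ) < p + α := by positivity
  have hrate : stepRate α m p ≤ (1 / α) * ((p : ℝ) + 2)⁻¹ := by
    rw [stepRate, ← div_eq_mul_inv, div_div]
    have : α * ((p : ℝ) + 2) ≤ 2 * (m * (p + α)) := by
      calc α * ((p : ℝ) + 2) ≤ 2 * (1 * (p + α)) := by nlinarith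
        _ ≤ _ := by gcongr
    rw [div_le_div_iff₀ (by positivity) (by positivity)]
    nlinarith [mul_pos (by linarith : (0 : ℝ) < m) hpa, mul_pos hα h2]
  have hratio : degreeRate α (p + 2) / degreeRate α u ≤
      Real.exp (1 / α) * (((p : ℝ) + 2) ^ (1 / 2 - α / 4) * (u : ℝ) ^ (-(1 / 2 - α / 4))) := by
    rw [div_le_iff₀ (degreeRate_pos α hu1)]
    have hle : degreeRate α (p + 2) ≤ ((p : ℝ) + 2) ^ (1 / 2 - α / 4) := by
      unfold degreeRate
      push_cast
      refine mul_le_of_le_one_right (by positivity) (Real.exp_le_one_iff.2 ?_)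
      rw [neg_div]
      exact neg_nonpos.2 (by positivity)
    refine hle.trans ?_
    unfold degreeRate
    have hmul : (u : ℝ) ^ (-(1 / 2 - α / 4)) * (u : ℝ) ^ (1 / 2 - α / 4) = 1 := by
      rw [← Real.rpow_add hu0, neg_add_cancel, Real.rpow_zero]
    have hexp : 1 ≤ Real.exp (1 / α) * Real.exp (-(1 / α) / u) := by
      rw [← Real.exp_add]
      refine Real.one_le_exp ?_
      have : 1 / α / u ≤ 1 / α := div_le_self (by positivity) hu1'
      rw [neg_div]
      linarith
    calc _ ≤ ((p : ℝ) + 2) ^ (1 / 2 - α / 4) * (Real.exp (1 / α) * Real.exp (-(1 / α) / u)) *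
          ((u : ℝ) ^ (-(1 / 2 - α / 4)) * (u : ℝ) ^ (1 / 2 - α / 4)) := by
          rw [hmul, mul_one]
          exact le_mul_of_one_le_right (by positivity) hexp
      _ = _ := by ring
  have hker : edgeKernel (α / 4) s(p + 2, u) =
      ((p : ℝ) + 2)⁻¹ * ((p : ℝ) + 2) ^ (1 / 2 - α / 4) * (u : ℝ) ^ (-(1 / 2 - α / 4)) := by
    rw [Sym2.eq_swap, edgeKernel_of_le _ (by omega), ← Real.rpow_neg_one, ← Real.rpow_add h2]
    push_cast
    congr 2 <;> ring
  have hratio0 : 0 ≤ degreeRate α (p + 2) / degreeRate α u :=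
    div_nonneg (degreeRate_pos α (by omega)).le (degreeRate_pos α hu1).le
  calc _ ≤ (1 / α) * ((p : ℝ) + 2)⁻¹ * (M * (Real.exp (1 / α) *
        (((p : ℝ) + 2) ^ (1 / 2 - α / 4) * (u : ℝ) ^ (-(1 / 2 - α / 4))))) := by gcongr
    _ = _ := by rw [hker]; ring

theorem dominates_edgeKernel {α : ℝ} (hα : 0 < α) (hα1 : α ≤ 1) {m : ℕ} (hm : 1 ≤ m) (M : ℕ) :
    Dominates α m M (fun t => ENNReal.ofReal (degreeRate α t)) fun e =>
      ENNReal.ofReal (M * (1 / α) * Real.exp (1 / α) * edgeKernel (α / 4) e) where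
  ne_zero t ht := by simpa using degreeRate_pos α ht
  ne_top t := ENNReal.ofReal_ne_top
  growth p := by
    have h0 : 0 ≤ stepRate α m p := div_nonneg (by linarith) (by positivity)
    rw [← ENNReal.ofReal_one, ← ENNReal.ofReal_add zero_le_one h0,
      ← ENNReal.ofReal_pow (by positivity), ← ENNReal.ofReal_mul (degreeRate_pos α (by omega)).le]
    exact ENNReal.ofReal_le_ofReal (degreeRate_mul_le hα hα1 hm p)
  edge p u hu := by
    have h0 : 0 ≤ stepRate α m p := div_nonneg (by linarith) (by positivity)
    rw [← ENNReal.ofReal_div_of_pos (degreeRate_pos α (Finset.mem_Icc.1 hu).1),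
      ← ENNReal.ofReal_natCast M, ← ENNReal.ofReal_mul (by positivity), ← ENNReal.ofReal_mul h0]
    exact ENNReal.ofReal_le_ofReal (stepRate_mul_le hα hα1 hm (by positivity) hu)

/-! ### Cycles as closed walks, and the union bound. -/

/-- The edges of a closed walk. -/
def walkEdges {l : ℕ} (w : Fin l → ℕ) : Edges :=
  (Finset.univ : Finset (Fin l)).val.map fun i => s(w i, w (finRotate l i))

theorem walkEdges_add_right {L : ℕ} (w : Fin (L + 1) → ℕ) (i : Fin (L + 1)) :
    walkEdges (fun j => w (j + i)) = walkEdges w := by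
  have h : (Finset.univ : Finset (Fin (L + 1))).val =
      (Finset.univ : Finset (Fin (L + 1))).val.map (Equiv.addRight i) :=
    (congrArg Finset.val (Finset.map_univ_equiv (Equiv.addRight i))).symm
  conv_rhs => rw [walkEdges, h, Multiset.map_map]
  refine Multiset.map_congr rfl fun j _ => ?_
  simp [add_right_comm]

/-- A cycle through the last vertex may be written as a closed walk which starts there. -/
theorem exists_walkEdges_le {α : ℝ} (hα : 0 < α) (hα1 : α ≤ 1) {m : ℕ} (hm : 1 ≤ m) {L p : ℕ}
    {E : Edges} (hE : E ∈ (graphLaw α m (p + 1)).support) (h : CycleCreated (L + 1) (p + 1) E) :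
    ∃ v : Fin L → Fin (p + 2), walkEdges (fun i =>
      ((Fin.cons (Fin.last (p + 1)) v : Fin (L + 1) → Fin (p + 2)) i : ℕ)) ≤ E := by
  -- Distinctness of the vertices is discarded: the union bound can afford all closed walks, as
  -- multiplicities are kept in the multiset of edges.
  obtain ⟨w, ⟨-, hw⟩, i, hi⟩ := h
  -- Labels beyond `p + 1` have degree 0, so no cycle visits them and the walks range over a finite
  -- set.
  have hle : ∀ j, w j ≤ p + 1 := by
    intro j
    by_contra hj
    rcases Nat.lt_or_ge (p + 2) (w j) with hlt | hge
    · have hd := (balanced_graphLaw hα hα1 hm p E hE).2.2 (w j) hlt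
      exact Multiset.countP_eq_zero.1 hd s(w j, w (finRotate _ j))
        (Multiset.mem_of_le hw (Multiset.mem_map_of_mem _ (Finset.mem_univ j)))
        (Sym2.mem_mk_left _ _)
    · have hd := (balanced_graphLaw hα hα1 hm p E hE).2.1
      rw [show p + 2 = w j by omega] at hd
      exact Multiset.countP_eq_zero.1 hd s(w j, w (finRotate _ j))
        (Multiset.mem_of_le hw (Multiset.mem_map_of_mem _ (Finset.mem_univ j)))
        (Sym2.mem_mk_left _ _)
  refine ⟨fun j => ⟨w (j.succ + i), Nat.lt_succ_of_le (hle _)⟩, ?_⟩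
  have hf : (fun j : Fin (L + 1) => ((Fin.cons (Fin.last (p + 1))
      (fun j : Fin L => (⟨w (j.succ + i), Nat.lt_succ_of_le (hle _)⟩ : Fin (p + 2))) :
        Fin (L + 1) → Fin (p + 2)) j : ℕ)) = fun j => w (j + i) := by
    funext j
    refine Fin.cases ?_ (fun j => ?_) j
    · simp [hi]
    · simp
  rw [hf, walkEdges_add_right]
  exact hw

open Classical in
theorem cycleProb_le {α : ℝ} (hα : 0 < α) (hα1 : α ≤ 1) {m : ℕ} (hm : 1 ≤ m) (L p : ℕ) :
    cycleProb α m (L + 1) (p + 1) ≤ ∑ v : Fin L → Fin (p + 2),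
      expect (graphLaw α m (p + 1)) (Set.indicator {E | walkEdges (fun i =>
        ((Fin.cons (Fin.last (p + 1)) v : Fin (L + 1) → Fin (p + 2)) i : ℕ)) ≤ E} 1) := by
  rw [← expect_sum]
  have h : cycleProb α m (L + 1) (p + 1) = expect (graphLaw α m (p + 1))
      (Set.indicator {E | CycleCreated (L + 1) (p + 1) E} 1) := by
    rw [cycleProb, PMF.toOuterMeasure_apply]
    refine tsum_congr fun E => ?_
    by_cases hE : E ∈ {E | CycleCreated (L + 1) (p + 1) E} <;> simp [hE]
  rw [h]
  refine expect_mono fun E hE => ?_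
  by_cases hc : CycleCreated (L + 1) (p + 1) E
  · obtain ⟨v, hv⟩ := exists_walkEdges_le hα hα1 hm hE hc
    refine le_trans ?_ (Finset.single_le_sum (fun _ _ => zero_le) (Finset.mem_univ v))
    rw [Set.indicator_of_mem (by exact hc), Set.indicator_of_mem (by exact hv)]
  · rw [Set.indicator_of_notMem (by exact hc)]
    exact zero_le

theorem mul_cycleProb_le {α : ℝ} (hα : 0 < α) (hα1 : α ≤ 1) {m : ℕ} (hm : 1 ≤ m) (L p : ℕ) :
    ((p + 1 : ℕ) : ℝ≥0∞) * cycleProb α m (L + 1) (p + 1) ≤ ENNReal.ofReal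
      ((m * ((5 * m + (L + 1) : ℕ) * (1 / α) * Real.exp (1 / α))) ^ (L + 1) *
        (2 / (α / 4)) ^ L) := by
  set Q : ℝ := (5 * m + (L + 1) : ℕ) * (1 / α) * Real.exp (1 / α) with hQ
  have hQ0 : 0 ≤ Q := by positivity
  have hterm : ∀ w : Fin (L + 1) → ℕ, expect (graphLaw α m (p + 1))
      (Set.indicator {E | walkEdges w ≤ E} 1) ≤ ENNReal.ofReal ((m * Q) ^ (L + 1) *
        ∏ i, edgeKernel (α / 4) s(w i, w (finRotate _ i))) := by
    intro w
    have hcard : (walkEdges w).card = L + 1 := by simp [walkEdges]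
    refine (expect_graphLaw_indicator_le hα hα1 hm (walkEdges w)
      (dominates_edgeKernel hα hα1 hm _) p).trans (le_of_eq ?_)
    rw [hcard, ← hQ, walkEdges, Multiset.map_map]
    simp only [Function.comp_def]
    rw [show ∀ f : Fin (L + 1) → ℝ≥0∞, (Finset.univ.val.map f).prod = ∏ i, f i from fun _ => rfl,
      ← Fin.prod_const, ← Finset.prod_mul_distrib, ENNReal.ofReal_prod_of_nonneg fun i _ =>
        mul_nonneg (by positivity) (edgeKernel_nonneg _ _)]
    refine Finset.prod_congr rfl fun i _ => ?_
    rw [mul_assoc (m : ℝ), ENNReal.ofReal_mul (Nat.cast_nonneg m), ENNReal.ofReal_natCast]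
  have hnn : ∀ w : Fin (L + 1) → ℕ, 0 ≤ (m * Q) ^ (L + 1) *
      ∏ i, edgeKernel (α / 4) s(w i, w (finRotate _ i)) := fun w =>
    mul_nonneg (by positivity) (Finset.prod_nonneg fun _ _ => edgeKernel_nonneg _ _)
  refine (mul_le_mul_right ((cycleProb_le hα hα1 hm L p).trans
    (Finset.sum_le_sum fun v _ => hterm _)) _).trans ?_
  rw [← ENNReal.ofReal_sum_of_nonneg fun v _ => hnn _, ← ENNReal.ofReal_natCast,
    ← ENNReal.ofReal_mul (Nat.cast_nonneg _), ← Finset.mul_sum]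
  refine ENNReal.ofReal_le_ofReal ?_
  have hN : (0 : ℝ) < (p + 1 : ℕ) := by positivity
  have hh : ((p + 1 : ℕ) : ℝ) * (((p + 1 : ℕ) : ℝ) ^ (-(1 / 2) : ℝ) *
      ((p + 1 : ℕ) : ℝ) ^ (-(1 / 2) : ℝ)) = 1 := by
    rw [← Real.rpow_add hN, show (-(1 / 2) + -(1 / 2) : ℝ) = -1 by norm_num, Real.rpow_neg_one,
      mul_inv_cancel₀ hN.ne']
  calc _ ≤ ((p + 1 : ℕ) : ℝ) * ((m * Q) ^ (L + 1) * ((2 / (α / 4)) ^ L *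
        (((p + 1 : ℕ) : ℝ) ^ (-(1 / 2) : ℝ) * ((p + 1 : ℕ) : ℝ) ^ (-(1 / 2) : ℝ)))) := by
        gcongr
        exact sum_closed_paths_le (by positivity) (by linarith) L (p + 1)
    _ = (m * Q) ^ (L + 1) * (2 / (α / 4)) ^ L * (((p + 1 : ℕ) : ℝ) *
        (((p + 1 : ℕ) : ℝ) ^ (-(1 / 2) : ℝ) * ((p + 1 : ℕ) : ℝ) ^ (-(1 / 2) : ℝ))) := by ring
    _ = _ := by rw [hh, mul_one]

end PrefAttach

theorem proposition4p6 (α : ℝ) (hα : 0 < α) (hα1 : α ≤ 1) (m : ℕ) (hm : 1 ≤ m)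
    (l : ℕ) (hl : 2 ≤ l) :
    (⨆ n : ℕ, (n : ENNReal) * PrefAttach.cycleProb α m l n) < ⊤ := by
  obtain ⟨L, rfl⟩ : ∃ L, l = L + 1 := ⟨l - 1, by omega⟩
  refine lt_of_le_of_lt (b := ENNReal.ofReal ((m * ((5 * m + (L + 1) : ℕ) * (1 / α) *
    Real.exp (1 / α))) ^ (L + 1) * (2 / (α / 4)) ^ L)) (iSup_le fun n => ?_) ENNReal.ofReal_lt_top
  cases n with
  | zero => simp
  | succ p => exact PrefAttach.mul_cycleProb_le hα hα1 hm L p
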